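/- An entire function $f$ is said to have exponential type at most $\sigma$ if for every $\epsilon>0$ there is a constant $A$ with $|f(z)|\le A e^{(\sigma+\epsilon)|z|}$ for all $z\in\mathbb{C}$. Let $$\|f\|_{BMO}=\sup_{I}\frac{1}{|I|}\int_{I}\Big|f(t)-\frac{1}{|I|}\int_{I}f(s)\,ds\Big|\,dt,$$ where the supremum runs over all bounded intervals $I\subset\mathbb{R}$ of positive length. For $b>0$, let $PW_b^{\star}$ be the vector space of all entire functions $f$ of exponential type at most $\pi b$ whose restriction to $\mathbb{R}$ satisfies $\|f\|_{BMO}<\infty$, and for $c\in\mathbb{C}$ put $\|f\|_{BMO,c}=|f(c)|+\|f\|_{BMO}$. Then the following statements hold. (I) For each $f\in PW_b^{\star}$ and each $c\in\mathbb{R}$, the function $x\mapsto f(x+ic)$ is uniformly Lipschitz continuous on $\mathbb{R}$, i.e. there is a finite $K$ with $|f(x+ic)-f(y+ic)|\le K|x-y|$ for all $x,y\in\mathbb{R}$. (II) For any fixed $c,c'\in\mathbb{C}$, the norms $\|\cdot\|_{BMO,c}$ and $\|\cdot\|_{BMO,c'}$ are equivalent on $PW_b^{\star}$: there is a constant $C=C(b,c,c')<\infty$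 such that $\|f\|_{BMO,c}\le C\|f\|_{BMO,c'}$ and $\|f\|_{BMO,c'}\le C\|f\|_{BMO,c}$ for all $f\in PW_b^{\star}$. (III) For any given $z\in\mathbb{C}$, the point evaluation functional $f\mapsto f(z)$ is bounded on $PW_b^{\star}$: for every $c\in\mathbb{C}$ there is a constant $C=C(b,c,z)<\infty$ such that $|f(z)|\le C\|f\|_{BMO,c}$ for all $f\in PW_b^{\star}$. (IV) There is a constant $C=C(b)<\infty$ such that $\|f'\|_{L^{\infty}(\mathbb{R})}\le C\|f\|_{BMO}$ for all $f\in PW_b^{\star}$. -/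

import Mathlib

open MeasureTheory
open scoped ENNReal NNReal

noncomputable section

namespace BandlimitedBMO

/-- The exponents `β` for which `f` is entire with `|f(z)| ≤ C e^{β|z|}` on `ℂ` for some `C`. -/
def growthExponents (f : ℂ → ℂ) : Set ℝ :=
  {β : ℝ | Differentiable ℂ f ∧ ∃ C : ℝ, ∀ z : ℂ, ‖f z‖ ≤ C * Real.exp (β * ‖z‖)}

/-- The exponential type of `f`: the infimum of the growth exponents, in the extended reals.
It is `⊤` if `f` is not entire or not of exponential type. -/
def expType (f : ℂ → ℂ) : EReal :=
  sInf ((fun β : ℝ => (β : EReal)) '' growthExponents f)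

/-- The mean oscillation over `[a, b]` of a (locally integrable) function `g` on the real line. -/
def meanOsc (g : ℝ → ℂ) (a b : ℝ) : ℝ≥0∞ :=
  (∫⁻ t in Set.Icc a b, ‖g t - ⨍ s in Set.Icc a b, g s‖ₑ) / ENNReal.ofReal (b - a)

/-- The BMO seminorm of a (locally integrable) function `g` on the real line, possibly infinite. -/
def bmoSeminorm (g : ℝ → ℂ) : ℝ≥0∞ :=
  ⨆ (a : ℝ) (b : ℝ) (_ : a < b), meanOsc g a b

/-- The BMO seminorm of the restriction of `f : ℂ → ℂ` to the real line. -/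
def bmo (f : ℂ → ℂ) : ℝ≥0∞ := bmoSeminorm fun x : ℝ => f x

/-- `|f(c)| + ‖f‖_BMO`. -/
def bmoNormAt (c : ℂ) (f : ℂ → ℂ) : ℝ≥0∞ := ‖f c‖ₑ + bmo f

lemma expType_le_iff (f : ℂ → ℂ) (σ : ℝ) :
    expType f ≤ σ ↔ ∀ τ : ℝ, σ < τ → τ ∈ growthExponents f := by
  constructor
  · intro h τ hτ
    have h1 : expType f < (τ : EReal) := lt_of_le_of_lt h (by exact_mod_cast hτ)
    obtain ⟨_, ⟨β, ⟨hd, C, hC⟩, rfl⟩, hβ⟩ := sInf_lt_iff.1 h1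
    have hβτ : β < τ := EReal.coe_lt_coe_iff.1 hβ
    refine ⟨hd, C, fun z => (hC z).trans ?_⟩
    have hC0 : 0 ≤ C := by
      have := (norm_nonneg _).trans (hC 0)
      simpa using this
    gcongr
  · intro h
    refine le_of_forall_gt_imp_ge_of_dense fun x hx => ?_
    obtain ⟨τ, h1, h2⟩ := EReal.lt_iff_exists_real_btwn.1 hx
    have h3 : (τ : EReal) ∈ (fun β : ℝ => (β : EReal)) '' growthExponents f :=
      ⟨τ, h τ (EReal.coe_lt_coe_iff.1 h1), rfl⟩
    exact (sInf_le h3).trans h2.le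

lemma expType_add_le {f g : ℂ → ℂ} {σ : ℝ} (hf : expType f ≤ σ) (hg : expType g ≤ σ) :
    expType (f + g) ≤ σ := by
  rw [expType_le_iff] at *
  intro τ hτ
  obtain ⟨hf, C, hC⟩ := hf τ hτ
  obtain ⟨hg, D, hD⟩ := hg τ hτ
  refine ⟨hf.add hg, C + D, fun z => ?_⟩
  rw [add_mul]
  exact (norm_add_le _ _).trans (add_le_add (hC z) (hD z))

lemma expType_smul_le {f : ℂ → ℂ} {σ : ℝ} (k : ℂ) (hf : expType f ≤ σ) :
    expType (k • f) ≤ σ := by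
  rw [expType_le_iff] at *
  intro τ hτ
  obtain ⟨hf, C, hC⟩ := hf τ hτ
  refine ⟨hf.const_smul k, ‖k‖ * C, fun z => ?_⟩
  rw [mul_assoc, Pi.smul_apply, norm_smul]
  exact mul_le_mul_of_nonneg_left (hC z) (norm_nonneg _)

lemma expType_zero_le (σ : ℝ) : expType 0 ≤ σ := by
  rw [expType_le_iff]
  exact fun τ _ => ⟨differentiable_const _, 0, fun z => by simp⟩

lemma continuous_of_expType_le {f : ℂ → ℂ} {σ : ℝ} (hf : expType f ≤ σ) :
    Continuous fun x : ℝ => f x :=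
  ((expType_le_iff f σ).1 hf (σ + 1) (by linarith)).1.continuous.comp Complex.continuous_ofReal

lemma meanOsc_le_bmoSeminorm (g : ℝ → ℂ) {a b : ℝ} (hab : a < b) :
    meanOsc g a b ≤ bmoSeminorm g :=
  le_iSup_of_le a (le_iSup_of_le b (le_iSup_of_le hab le_rfl))

lemma bmoSeminorm_add_le {g h : ℝ → ℂ} (hg : Continuous g) (hh : Continuous h) :
    bmoSeminorm (g + h) ≤ bmoSeminorm g + bmoSeminorm h := by
  refine iSup_le fun a => iSup_le fun b => iSup_le fun hab => ?_
  refine le_trans ?_ (add_le_add (meanOsc_le_bmoSeminorm g hab) (meanOsc_le_bmoSeminorm h hab))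
  have ig : IntegrableOn g (Set.Icc a b) := hg.continuousOn.integrableOn_Icc
  have ih : IntegrableOn h (Set.Icc a b) := hh.continuousOn.integrableOn_Icc
  have key : ⨍ s in Set.Icc a b, (g + h) s
      = (⨍ s in Set.Icc a b, g s) + ⨍ s in Set.Icc a b, h s := by
    simp only [setAverage_eq, Pi.add_apply]
    rw [integral_add ig ih, smul_add]
  simp only [meanOsc, key]
  rw [← ENNReal.add_div, ← lintegral_add_left (by fun_prop)]
  gcongr with t
  rw [Pi.add_apply, add_sub_add_comm]
  exact enorm_add_le _ _

lemma bmoSeminorm_smul_le (k : ℂ) (g : ℝ → ℂ) :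
    bmoSeminorm (k • g) ≤ ‖k‖ₑ * bmoSeminorm g := by
  refine iSup_le fun a => iSup_le fun b => iSup_le fun hab => ?_
  refine le_trans (le_of_eq ?_) (mul_le_mul_right (meanOsc_le_bmoSeminorm g hab) _)
  have key : ⨍ s in Set.Icc a b, (k • g) s = k • ⨍ s in Set.Icc a b, g s := by
    simp only [setAverage_eq, Pi.smul_apply]
    rw [integral_smul, smul_comm]
  simp only [meanOsc, key]
  simp only [Pi.smul_apply, ← smul_sub, enorm_smul]
  rw [lintegral_const_mul' _ _ (by simp), mul_div_assoc]

/-- The space `PW_b^⋆` of entire functions of exponential type at most `π b` whose restriction to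
the real line has finite BMO seminorm. As `|f(c)|` is finite for each `c`, the latter is the same
as finiteness of `|f(c)| + ‖f‖_BMO`, for any `c`. -/
def PWStar (b : ℝ) : Submodule ℂ (ℂ → ℂ) where
  carrier := {f | expType f ≤ ((Real.pi * b : ℝ) : EReal) ∧ bmo f < ∞}
  add_mem' {f g} hf hg := ⟨expType_add_le hf.1 hg.1,
    (bmoSeminorm_add_le (continuous_of_expType_le hf.1) (continuous_of_expType_le hg.1)).trans_lt
      (ENNReal.add_lt_top.2 ⟨hf.2, hg.2⟩)⟩
  zero_mem' := ⟨expType_zero_le _, by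
    simp [bmo, bmoSeminorm, meanOsc]⟩
  smul_mem' k f hf := ⟨expType_smul_le k hf.1,
    (bmoSeminorm_smul_le k _).trans_lt (ENNReal.mul_lt_top (by simp) hf.2)⟩

/-- The point evaluation functional `f ↦ f(z)` on `PW_b^⋆`. -/
def evalAt (b : ℝ) (z : ℂ) : PWStar b →ₗ[ℂ] ℂ :=
  (LinearMap.proj z).comp (PWStar b).subtype

end BandlimitedBMO

end

namespace BandlimitedBMO

open Complex Filter Set

/-! Everything follows from a bound for `f'` by a multiple of the BMO seminorm, uniform on each
horizontal strip (`norm_deriv_le`). BMO controls only integrals of `f`, so the argument passes to a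
primitive `G` of `f(· + x₀) - m`, where `m` is the mean of `f` over `[x₀ - 1, x₀ + 1]`. Comparing
means over nested intervals gives `|G(x)| ≤ 4B(1 + |x|)²` on the line, `B` being the seminorm
(`setIntegral_norm_sub_unit_average_le`). Since `G` has exponential type, Phragmén–Lindelöf carries
this bound into the plane (`norm_le_of_quadratic_growth`), and Cauchy's estimate for `G'' = f'(· +
x₀)` on a unit circle concludes. The constants do not depend on `x₀`. -/

/-- Phragmén–Lindelöf in the upper half plane, for entire functions of exponential type which grow
at most quadratically on the real line. -/
lemma norm_le_of_quadratic_growth_of_im_nonneg {G : ℂ → ℂ} (hG : Differentiable ℂ G) {A τ M : ℝ}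
    (hτ : 0 ≤ τ) (hA : ∀ z, ‖G z‖ ≤ A * Real.exp (τ * ‖z‖))
    (hM : ∀ x : ℝ, ‖G x‖ ≤ M * (1 + |x|) ^ 2) {z : ℂ} (hz : 0 ≤ z.im) :
    ‖G z‖ ≤ 2 * M * (1 + ‖z‖) ^ 2 * Real.exp (τ * z.im) := by
  have hA0 : 0 ≤ A := by simpa using (norm_nonneg _).trans (hA 0)
  have hM0 : 0 ≤ M := by simpa using (norm_nonneg _).trans (hM 0)
  have hone : ∀ w : ℂ, 0 ≤ w.re → 1 ≤ ‖1 + w‖ := fun w hw =>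
    le_trans (by simpa using hw) (Complex.re_le_norm (1 + w))
  have hne : ∀ w : ℂ, 0 ≤ w.re → 1 + w ≠ 0 := fun w hw =>
    norm_pos_iff.1 (one_pos.trans_le (hone w hw))
  -- Multiplication by `I` turns the right half plane into the upper one. The exponential keeps `φ`
  -- bounded on the positive ray, and `(1 + w)²`, which has no zero for `w.re ≥ 0`, absorbs the
  -- quadratic growth on the imaginary axis. The bound `A` on the ray does not enter the conclusion.
  set φ : ℂ → ℂ := fun w => exp (-τ * w) * G (I * w) / (1 + w) ^ 2 with hφ
  have hnorm : ∀ w, ‖φ w‖ = Real.exp (-τ * w.re) * ‖G (I * w)‖ / ‖1 + w‖ ^ 2 := fun w => by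
    simp [hφ, Complex.norm_exp]
  have hbound : ∀ w : ℂ, 0 ≤ w.re →
      ‖φ w‖ ≤ A * (Real.exp (-τ * w.re) * Real.exp (τ * ‖w‖)) := fun w hw => by
    rw [hnorm]
    refine (div_le_self (by positivity) (one_le_pow₀ (hone w hw))).trans ?_
    have h := hA (I * w)
    rw [norm_mul, norm_I, one_mul] at h
    calc _ ≤ Real.exp (-τ * w.re) * (A * Real.exp (τ * ‖w‖)) := by gcongr
      _ = _ := by ring
  have key : ‖φ (-I * z)‖ ≤ 2 * M := by
    refine PhragmenLindelof.right_half_plane_of_bounded_on_real ?_ ⟨1, by norm_num, τ, ?_⟩ ?_ ?_ ?_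
    · refine DifferentiableOn.diffContOnCl fun w hw => ?_
      rw [closure_setOfPred_lt_re] at hw
      refine DifferentiableAt.differentiableWithinAt ?_
      refine DifferentiableAt.div ?_ (by fun_prop) (pow_ne_zero _ (hne w hw))
      exact DifferentiableAt.mul (by fun_prop) ((hG _).comp w (by fun_prop))
    · refine Asymptotics.IsBigO.of_bound A ?_
      refine eventually_inf_principal.2 (Eventually.of_forall fun w (hw : 0 < w.re) => ?_)
      refine (hbound w hw.le).trans ?_
      rw [Real.rpow_one, Real.norm_eq_abs, Real.abs_exp]
      gcongr
      refine mul_le_of_le_one_left (Real.exp_pos _).le (Real.exp_le_one_iff.2 ?_)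
      nlinarith
    · refine isBoundedUnder_of_eventually_le (a := A) ?_
      filter_upwards [eventually_ge_atTop 0] with x hx
      refine (hbound x (by simpa using hx)).trans_eq ?_
      rw [← Real.exp_add]
      simp [abs_of_nonneg hx]
    · intro x
      rw [hnorm]
      have h1 : I * (x * I) = ((-x : ℝ) : ℂ) := by
        push_cast
        linear_combination (x : ℂ) * I_mul_I
      have h2 : ‖1 + (x : ℂ) * I‖ ^ 2 = 1 + x ^ 2 := by
        rw [← Complex.normSq_eq_norm_sq, Complex.normSq_apply]
        simp [pow_two]
      have h3 := hM (-x)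
      rw [abs_neg] at h3
      rw [h1, h2, div_le_iff₀ (by positivity)]
      have h4 : -τ * (x * I : ℂ).re = 0 := by simp
      rw [h4, Real.exp_zero, one_mul]
      refine h3.trans ?_
      rw [mul_comm 2 M, mul_assoc]
      gcongr
      -- The factor 2 comes from `(1 + |x|)² ≤ 2(1 + x²)`.
      nlinarith [sq_nonneg (|x| - 1), sq_abs x]
    · simpa using hz
  have hI : I * (-I * z) = z := by linear_combination (-z) * I_mul_I
  have hre : (-I * z).re = z.im := by simp
  rw [hnorm, hI, hre, div_le_iff₀ (pow_pos (one_pos.trans_le (hone _ (by simpa using hz))) 2)] at key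
  have h5 : ‖1 + -I * z‖ ≤ 1 + ‖z‖ := (norm_add_le _ _).trans (by simp)
  have h6 : Real.exp (τ * z.im) * Real.exp (-τ * z.im) = 1 := by
    rw [← Real.exp_add]
    simp
  calc ‖G z‖ = Real.exp (τ * z.im) * (Real.exp (-τ * z.im) * ‖G z‖) := by
        rw [← mul_assoc, h6, one_mul]
    _ ≤ Real.exp (τ * z.im) * (2 * M * (1 + ‖z‖) ^ 2) := by
        refine mul_le_mul_of_nonneg_left (key.trans ?_) (Real.exp_pos _).le
        gcongr
    _ = _ := by ring

lemma norm_le_of_quadratic_growth {G : ℂ → ℂ} (hG : Differentiable ℂ G) {A τ M : ℝ}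
    (hτ : 0 ≤ τ) (hA : ∀ z, ‖G z‖ ≤ A * Real.exp (τ * ‖z‖))
    (hM : ∀ x : ℝ, ‖G x‖ ≤ M * (1 + |x|) ^ 2) (z : ℂ) :
    ‖G z‖ ≤ 2 * M * (1 + ‖z‖) ^ 2 * Real.exp (τ * |z.im|) := by
  rcases le_total 0 z.im with hz | hz
  · rw [abs_of_nonneg hz]
    exact norm_le_of_quadratic_growth_of_im_nonneg hG hτ hA hM hz
  · rw [abs_of_nonpos hz]
    have h := norm_le_of_quadratic_growth_of_im_nonneg (G := fun w => G (-w)) (A := A) (M := M)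
      (by fun_prop) hτ (fun w => by simpa using hA (-w))
      (fun x => by simpa using hM (-x)) (z := -z) (by simpa using hz)
    simpa using h

/-! ### Mean oscillation over growing intervals -/

lemma setIntegral_norm_sub_average_le {g : ℝ → ℂ} (hg : Continuous g) (hB : bmoSeminorm g ≠ ∞)
    {a b : ℝ} (hab : a < b) :
    ∫ t in Icc a b, ‖g t - ⨍ s in Icc a b, g s‖ ≤ (b - a) * (bmoSeminorm g).toReal := by
  have hi : IntegrableOn (fun t => g t - ⨍ s in Icc a b, g s) (Icc a b) :=
    (hg.sub continuous_const).continuousOn.integrableOn_Icc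
  have h := meanOsc_le_bmoSeminorm g hab
  have hpos : 0 < b - a := sub_pos.2 hab
  rw [meanOsc, ← ofReal_integral_norm_eq_lintegral_enorm hi, ← ENNReal.ofReal_div_of_pos hpos] at h
  have h' := (ENNReal.ofReal_le_iff_le_toReal hB).1 h
  rwa [div_le_iff₀ hpos, mul_comm] at h'

/-- The oscillation of a BMO function around its mean over `[x₀ - 1, x₀ + 1]`, integrated over
`[x₀ - R, x₀ + R]`, grows at most quadratically in `R`. -/
lemma setIntegral_norm_sub_unit_average_le {g : ℝ → ℂ} (hg : Continuous g)
    (hB : bmoSeminorm g ≠ ∞) (x₀ : ℝ) {R : ℝ} (hR : 1 ≤ R) :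
    ∫ t in Icc (x₀ - R) (x₀ + R), ‖g t - ⨍ s in Icc (x₀ - 1) (x₀ + 1), g s‖
      ≤ 4 * (bmoSeminorm g).toReal * R ^ 2 := by
  set B := (bmoSeminorm g).toReal
  set m := ⨍ s in Icc (x₀ - 1) (x₀ + 1), g s with hm
  set n := ⨍ s in Icc (x₀ - R) (x₀ + R), g s with hn
  have hB0 : 0 ≤ B := ENNReal.toReal_nonneg
  have hint : ∀ (c : ℂ) (a b : ℝ), IntegrableOn (fun t => g t - c) (Icc a b) := fun c a b =>
    (hg.sub continuous_const).continuousOn.integrableOn_Icc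
  have h1 : ∫ t in Icc (x₀ - R) (x₀ + R), ‖g t - n‖ ≤ 2 * R * B := by
    refine (setIntegral_norm_sub_average_le hg hB (by linarith)).trans_eq ?_
    ring
  -- `m - n` is the mean of `g - n` over the short interval, of length 2; enlarging the domain of
  -- integration to the long one costs the ratio `R` of the lengths.
  have h2 : ‖m - n‖ ≤ R * B := by
    have h3 : (2 : ℝ) • (m - n) = ∫ t in Icc (x₀ - 1) (x₀ + 1), (g t - n) := by
      rw [integral_sub hg.continuousOn.integrableOn_Icc (by simp), hm, setAverage_eq,
        setIntegral_const]
      have h4 : volume.real (Icc (x₀ - 1) (x₀ + 1)) = 2 := by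
        rw [Real.volume_real_Icc_of_le (by linarith)]
        ring
      rw [h4, smul_sub, smul_inv_smul₀ two_ne_zero]
    have h5 : 2 * ‖m - n‖ ≤ 2 * R * B := by
      calc 2 * ‖m - n‖ = ‖(2 : ℝ) • (m - n)‖ := by rw [norm_smul, Real.norm_two]
        _ ≤ ∫ t in Icc (x₀ - 1) (x₀ + 1), ‖g t - n‖ := by
            rw [h3]
            exact norm_integral_le_integral_norm _
        _ ≤ ∫ t in Icc (x₀ - R) (x₀ + R), ‖g t - n‖ := by
            refine setIntegral_mono_set (hint n _ _).norm (ae_of_all _ fun t => norm_nonneg _) ?_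
            exact (Icc_subset_Icc (by linarith) (by linarith)).eventuallyLE
        _ ≤ _ := h1
    linarith
  calc ∫ t in Icc (x₀ - R) (x₀ + R), ‖g t - m‖
      ≤ ∫ t in Icc (x₀ - R) (x₀ + R), (‖g t - n‖ + ‖m - n‖) := by
        refine setIntegral_mono (hint m _ _).norm
          ((hint n _ _).norm.add (by simp)) fun t => ?_
        simpa using norm_sub_le (g t - n) (m - n)
    _ = (∫ t in Icc (x₀ - R) (x₀ + R), ‖g t - n‖) + 2 * R * ‖m - n‖ := by
        rw [integral_add (hint n _ _).norm (by simp), setIntegral_const,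
          Real.volume_real_Icc_of_le (by linarith), smul_eq_mul]
        ring
    _ ≤ 2 * R * B + 2 * R * (R * B) := by gcongr
    _ ≤ _ := by nlinarith [mul_nonneg hB0 (sub_nonneg.2 hR)]

/-! ### Derivative bound on horizontal strips -/

/-- A primitive of an entire function of exponential type is of exponential type. -/
lemma norm_le_of_deriv_exponential_growth {G : ℂ → ℂ} (hG : Differentiable ℂ G) (h0 : G 0 = 0)
    {A τ : ℝ} (hτ : 0 ≤ τ) (hA : ∀ z, ‖deriv G z‖ ≤ A * Real.exp (τ * ‖z‖)) (z : ℂ) :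
    ‖G z‖ ≤ A * Real.exp ((τ + 1) * ‖z‖) := by
  have hA0 : 0 ≤ A := by simpa using (norm_nonneg _).trans (hA 0)
  have h := (convex_closedBall (0 : ℂ) ‖z‖).norm_image_sub_le_of_norm_deriv_le
    (f := G) (C := A * Real.exp (τ * ‖z‖)) (x := 0) (y := z) (fun w _ => hG w)
    (fun w hw => (hA w).trans (by
      have : ‖w‖ ≤ ‖z‖ := by simpa using hw
      gcongr)) (by simp) (by simp)
  rw [h0, sub_zero, sub_zero] at h
  refine h.trans ?_
  rw [add_mul, one_mul, Real.exp_add, ← mul_assoc]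
  gcongr
  linarith [Real.add_one_le_exp ‖z‖]

/-- The constant in the bound for the derivative of a function of exponential type at most `σ`
by its BMO seminorm, at points at distance at most `r` from the real line. -/
noncomputable def derivConst (σ r : ℝ) : ℝ := 16 * (2 + r) ^ 2 * Real.exp ((σ + 2) * (1 + r))

lemma derivConst_nonneg (σ r : ℝ) : 0 ≤ derivConst σ r := by
  unfold derivConst
  positivity

/-- The growth constant `A` only makes Phragmén–Lindelöf applicable; it is absent from the resulting
bound, which is why the estimate is linear in the seminorm. -/
lemma norm_deriv_le {f : ℂ → ℂ} {σ : ℝ} (hσ : 0 ≤ σ) (hf : expType f ≤ σ) (hB : bmo f ≠ ∞)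
    {z : ℂ} {r : ℝ} (hz : |z.im| ≤ r) :
    ‖deriv f z‖ ≤ derivConst σ r * (bmo f).toReal := by
  obtain ⟨hd, A, hA⟩ := (expType_le_iff f σ).1 hf (σ + 1) (by linarith)
  have hcont := continuous_of_expType_le hf
  have hr : 0 ≤ r := (abs_nonneg _).trans hz
  set x₀ := z.re
  set g : ℝ → ℂ := fun x => f x
  set B := (bmo f).toReal
  have hB0 : 0 ≤ B := ENNReal.toReal_nonneg
  set m := ⨍ s in Icc (x₀ - 1) (x₀ + 1), g s
  have hA0 : 0 ≤ A := by simpa using (norm_nonneg _).trans (hA 0)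
  have hgd : Differentiable ℂ fun w => f (w + x₀) - m := by fun_prop
  obtain ⟨G, hG'⟩ := hgd.isExactOn_univ.with_val_at 0 0
  have hG0 : G 0 = 0 := hG'.1
  have hGd : ∀ w, HasDerivAt G (f (w + x₀) - m) w := fun w => hG'.2 w (mem_univ w)
  have hGdiff : Differentiable ℂ G := fun w => (hGd w).differentiableAt
  have hderiv : deriv G = fun w => f (w + x₀) - m := funext fun w => (hGd w).deriv
  have hgrow : ∀ w, ‖deriv G w‖ ≤
      (A * Real.exp ((σ + 1) * |x₀|) + ‖m‖) * Real.exp ((σ + 1) * ‖w‖) := fun w => by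
    rw [hderiv]
    have h1 : ‖w + x₀‖ ≤ ‖w‖ + |x₀| := (norm_add_le _ _).trans (by simp)
    have h2 : 1 ≤ Real.exp ((σ + 1) * ‖w‖) := Real.one_le_exp (by positivity)
    calc ‖f (w + x₀) - m‖ ≤ A * Real.exp ((σ + 1) * (‖w‖ + |x₀|)) + ‖m‖ := by
          refine (norm_sub_le _ _).trans (add_le_add_left ((hA _).trans ?_) _)
          gcongr
      _ ≤ A * Real.exp ((σ + 1) * (‖w‖ + |x₀|)) + ‖m‖ * Real.exp ((σ + 1) * ‖w‖) := by
          gcongr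
          exact le_mul_of_one_le_right (norm_nonneg _) h2
      _ = _ := by
          rw [mul_add, Real.exp_add]
          ring
  have hexp := norm_le_of_deriv_exponential_growth hGdiff hG0 (by linarith) hgrow
  have hreal : ∀ x : ℝ, ‖G x‖ ≤ 4 * B * (1 + |x|) ^ 2 := fun x => by
    have hc : Continuous fun t : ℝ => f (t + x₀) - m :=
      hgd.continuous.comp continuous_ofReal
    have h1 : ∫ t in (0 : ℝ)..x, (f (t + x₀) - m) = G x := by
      have := intervalIntegral.integral_eq_sub_of_hasDerivAt
        (fun t _ => (hGd t).comp_ofReal) (hc.intervalIntegrable 0 x)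
      simpa [hG0] using this
    have h2 : ∫ t in (0 : ℝ)..x, (f (t + x₀) - m) = ∫ t in x₀..(x + x₀), (g t - m) := by
      have := intervalIntegral.integral_comp_add_right (a := 0) (b := x) (fun t => g t - m) x₀
      simpa [g] using this
    rw [← h1, h2]
    refine intervalIntegral.norm_integral_le_integral_norm_uIoc.trans ?_
    refine le_trans ?_ (setIntegral_norm_sub_unit_average_le hcont hB x₀ (R := 1 + |x|)
      (by linarith [abs_nonneg x]))
    refine setIntegral_mono_set ?_ (ae_of_all _ fun t => norm_nonneg _) (LE.le.eventuallyLE ?_)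
    · exact (hcont.sub continuous_const).norm.continuousOn.integrableOn_Icc
    · refine uIoc_subset_uIcc.trans (uIcc_subset_Icc ?_ ?_) <;>
      constructor <;> linarith [abs_nonneg x, neg_abs_le x, le_abs_self x]
  have hPL := norm_le_of_quadratic_growth hGdiff (by linarith) hexp hreal
  -- In `σ + 2`, one unit comes from the slack in the exponential type and one from taking the
  -- primitive. The factor `2!` of the second derivative turns 8 into the 16 of `derivConst`.
  have hcauchy := norm_iteratedDeriv_le_of_forall_mem_sphere_norm_le (f := G) (c := z.im * I)
    (C := 8 * B * (2 + r) ^ 2 * Real.exp ((σ + 2) * (1 + r))) 2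
    one_pos hGdiff.diffContOnCl fun w hw => by
      have hw1 : ‖w - z.im * I‖ = 1 := by simpa [dist_eq_norm] using hw
      have hy : ‖(z.im : ℂ) * I‖ = |z.im| := by simp
      have hw2 : ‖w‖ ≤ 1 + r := by
        have := norm_le_norm_sub_add w (z.im * I)
        linarith
      have hw3 : |w.im| ≤ 1 + r := (abs_im_le_norm w).trans hw2
      refine (hPL w).trans ?_
      rw [show σ + 1 + 1 = σ + 2 by ring, show 2 * (4 * B) = 8 * B by ring]
      gcongr ?_ * ?_ ^ 2 * Real.exp (_ * ?_)
      linarith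
  have hsecond : iteratedDeriv 2 G (z.im * I) = deriv f z := by
    rw [iteratedDeriv_succ, iteratedDeriv_one, hderiv, deriv_sub_const,
      deriv_comp_add_const, add_comm, re_add_im]
  rw [hsecond] at hcauchy
  refine hcauchy.trans_eq ?_
  norm_num [derivConst, Nat.factorial]
  ring

/-! ### Consequences of the mean value inequality -/

lemma norm_sub_le_of_abs_im_le {f : ℂ → ℂ} {σ : ℝ} (hσ : 0 ≤ σ) (hf : expType f ≤ σ)
    (hB : bmo f ≠ ∞) {z w : ℂ} {r : ℝ} (hz : |z.im| ≤ r) (hw : |w.im| ≤ r) :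
    ‖f z - f w‖ ≤ derivConst σ r * (bmo f).toReal * ‖z - w‖ := by
  have hd : Differentiable ℂ f := ((expType_le_iff f σ).1 hf (σ + 1) (by linarith)).1
  have hconv : Convex ℝ (imLm ⁻¹' Icc (-r) r) := (convex_Icc (-r) r).linear_preimage imLm
  exact hconv.norm_image_sub_le_of_norm_deriv_le (fun u _ => hd u)
    (fun u hu => norm_deriv_le hσ hf hB (abs_le.2 hu)) (abs_le.1 hw) (abs_le.1 hz)

lemma exists_enorm_le_mul_bmoNormAt {b : ℝ} (hb : 0 < b) (c z : ℂ) :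
    ∃ C : ℝ≥0, ∀ f ∈ PWStar b, ‖f z‖ₑ ≤ C * bmoNormAt c f := by
  have hσ : 0 ≤ Real.pi * b := by positivity
  -- The smallest symmetric strip containing both `z` and `c`.
  set K := derivConst (Real.pi * b) (max |z.im| |c.im|)
  have hK : 0 ≤ K := derivConst_nonneg _ _
  refine ⟨(1 + K * ‖z - c‖).toNNReal, fun f hf => ?_⟩
  have hB : bmo f ≠ ∞ := hf.2.ne
  have h : ‖f z - f c‖ ≤ K * (bmo f).toReal * ‖z - c‖ :=
    norm_sub_le_of_abs_im_le hσ hf.1 hB (le_max_left _ _) (le_max_right _ _)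
  have hB0 : 0 ≤ (bmo f).toReal := ENNReal.toReal_nonneg
  have hreal : ‖f z‖ ≤ (1 + K * ‖z - c‖) * (‖f c‖ + (bmo f).toReal) := by
    have h1 := norm_le_norm_sub_add (f z) (f c)
    have h2 : 0 ≤ K * ‖z - c‖ * ‖f c‖ := by positivity
    linarith
  rw [bmoNormAt, ← ENNReal.ofReal_toReal hB, ← ofReal_norm, ← ofReal_norm,
    ← ENNReal.ofReal_add (norm_nonneg _) hB0]
  refine (ENNReal.ofReal_le_ofReal hreal).trans_eq ?_
  rw [ENNReal.ofReal_mul (by positivity)]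
  rfl

/-- Only the point value changes with the base point; the seminorm is common to both sides and
accounts for the `+ 1`. -/
lemma exists_bmoNormAt_le_mul {b : ℝ} (hb : 0 < b) (c c' : ℂ) :
    ∃ C : ℝ≥0, ∀ f ∈ PWStar b, bmoNormAt c f ≤ C * bmoNormAt c' f := by
  obtain ⟨C, hC⟩ := exists_enorm_le_mul_bmoNormAt hb c' c
  refine ⟨C + 1, fun f hf => ?_⟩
  rw [bmoNormAt, ENNReal.coe_add, add_mul, ENNReal.coe_one, one_mul]
  exact add_le_add (hC f hf) le_add_self

end BandlimitedBMO

theorem mainTheorem3 (b : ℝ) (hb : 0 < b) :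
    -- (I) horizontal translates are uniformly Lipschitz on the real line
    (∀ f ∈ BandlimitedBMO.PWStar b, ∀ c : ℝ, ∃ K : ℝ≥0,
      LipschitzWith K fun x : ℝ => f ((x : ℂ) + (c : ℂ) * Complex.I)) ∧
    -- (II) the norms for different base points are equivalent
    (∀ c c' : ℂ, ∃ C : ℝ≥0, ∀ f ∈ BandlimitedBMO.PWStar b,
      BandlimitedBMO.bmoNormAt c f ≤ C * BandlimitedBMO.bmoNormAt c' f ∧
      BandlimitedBMO.bmoNormAt c' f ≤ C * BandlimitedBMO.bmoNormAt c f) ∧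
    -- (III) point evaluations are bounded functionals, whichever base point norms the space
    (∀ c z : ℂ, ∃ C : ℝ≥0, ∀ f : BandlimitedBMO.PWStar b,
      ‖BandlimitedBMO.evalAt b z f‖ₑ ≤ C * BandlimitedBMO.bmoNormAt c f) ∧
    -- (IV) the sup norm on the real line of the derivative is controlled by the BMO seminorm
    (∃ C : ℝ≥0, ∀ f ∈ BandlimitedBMO.PWStar b,
      eLpNorm (fun x : ℝ => deriv f (x : ℂ)) ∞ volume ≤ C * BandlimitedBMO.bmo f) := by
  have hσ : 0 ≤ Real.pi * b := by positivity
  refine ⟨fun f hf c => ?_, fun c c' => ?_, fun c z => ?_, ?_⟩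
  · refine ⟨(BandlimitedBMO.derivConst (Real.pi * b) |c| * (BandlimitedBMO.bmo f).toReal).toNNReal,
      LipschitzWith.of_dist_le' fun x y => ?_⟩
    have h := BandlimitedBMO.norm_sub_le_of_abs_im_le hσ hf.1 hf.2.ne (r := |c|)
      (z := x + c * Complex.I) (w := y + c * Complex.I) (by simp) (by simp)
    rwa [add_sub_add_right_eq_sub, ← Complex.ofReal_sub, Complex.norm_real, ← dist_eq_norm,
      ← dist_eq_norm] at h
  · obtain ⟨C, hC⟩ := BandlimitedBMO.exists_bmoNormAt_le_mul hb c c'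
    obtain ⟨D, hD⟩ := BandlimitedBMO.exists_bmoNormAt_le_mul hb c' c
    refine ⟨max C D, fun f hf => ⟨(hC f hf).trans ?_, (hD f hf).trans ?_⟩⟩
    · gcongr
      exact le_max_left C D
    · gcongr
      exact le_max_right C D
  · obtain ⟨C, hC⟩ := BandlimitedBMO.exists_enorm_le_mul_bmoNormAt hb c z
    exact ⟨C, fun f => hC f f.2⟩
  · refine ⟨(BandlimitedBMO.derivConst (Real.pi * b) 0).toNNReal, fun f hf => ?_⟩
    rw [eLpNorm_exponent_top]
    refine eLpNormEssSup_le_of_ae_enorm_bound (ae_of_all _ fun x => ?_)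
    have h := BandlimitedBMO.norm_deriv_le hσ hf.1 hf.2.ne (z := x) (r := 0) (by simp)
    rw [← ofReal_norm, ← ENNReal.ofReal_toReal hf.2.ne]
    refine (ENNReal.ofReal_le_ofReal h).trans_eq ?_
    rw [ENNReal.ofReal_mul (BandlimitedBMO.derivConst_nonneg _ _)]
    rfl
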